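/- Let $p>2$ be a prime number, let $k$ be an algebraically closed field of characteristic $p$, and write a meromorphic differential form on $\mathbb{P}^1_k$ as $\omega=f(X)\,dX$ with $f\in k(X)$. For $\omega\neq 0$, its order at $a\in k$ is $\mathrm{ord}_a(f)$, and its order at $\infty$ is $\mathrm{ord}_0\big(f(1/X)\big)-2$. The form $\omega$ is called logarithmic if $\omega=\frac{dF}{F}$ for some $F\in k(X)^\times$. For integers $m,n\geq 1$, a space $L_{m+1,n}$ is an $n$-dimensional $\mathbb{F}_p$-vector space $\Omega$ of meromorphic differential forms on $\mathbb{P}^1_k$ such that every $\omega\in\Omega\setminus\{0\}$ is logarithmic, has no zero at any point of $k$, and has order $m-1$ at $\infty$. Then, for every $n\geq 1$, there exists no space $L_{p^{n-1},n}$; that is, there is no space $L_{m+1,n}$ with $m+1=p^{n-1}$. (For $n=1$ this holds by the convention $m\geq 1$.) -/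

import Mathlib

open scoped KaehlerDifferential

namespace SpacesL

noncomputable section

/-- Meromorphic differential forms on the projective line over `k`: the Kähler differentials of
the function field `k(X)` over `k`. -/
abbrev DiffForm (k : Type*) [Field k] : Type _ := Ω[RatFunc k⁄k]

/-- The form `dX`. -/
def dX (k : Type*) [Field k] : DiffForm k :=
  KaehlerDifferential.D k (RatFunc k) RatFunc.X

theorem dX_eq_map (k : Type*) [Field k] :
    dX k = KaehlerDifferential.map k k (Polynomial k) (RatFunc k)
      (KaehlerDifferential.D k (Polynomial k) Polynomial.X) := by
  rw [KaehlerDifferential.map_D, RatFunc.algebraMap_X, dX]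

theorem dX_ne_zero (k : Type*) [Field k] : dX k ≠ 0 := by
  intro h
  rw [dX_eq_map] at h
  obtain ⟨s, hs⟩ := (IsLocalizedModule.eq_zero_iff (nonZeroDivisors (Polynomial k))
    (KaehlerDifferential.map k k (Polynomial k) (RatFunc k))).1 h
  have h2 := congrArg (KaehlerDifferential.polynomialEquiv k) hs
  rw [Submonoid.smul_def, map_smul, KaehlerDifferential.polynomialEquiv_D] at h2
  simp at h2

theorem exists_eq_smul_dX {k : Type*} [Field k] (ω : DiffForm k) :
    ∃ f : RatFunc k, f • dX k = ω := by
  obtain ⟨⟨η, s⟩, hη⟩ := IsLocalizedModule.surj (nonZeroDivisors (Polynomial k))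
    (KaehlerDifferential.map k k (Polynomial k) (RatFunc k)) ω
  obtain ⟨P, rfl⟩ := (KaehlerDifferential.polynomialEquiv k).symm.surjective η
  have hs : algebraMap (Polynomial k) (RatFunc k) s ≠ 0 := by
    simp
  refine ⟨(algebraMap (Polynomial k) (RatFunc k) s)⁻¹ * algebraMap _ _ P, ?_⟩
  rw [Submonoid.smul_def, KaehlerDifferential.polynomialEquiv_symm, map_smul, ← dX_eq_map] at hη
  rw [mul_smul, algebraMap_smul, ← hη, ← algebraMap_smul (RatFunc k) (s : Polynomial k) ω,
    inv_smul_smul₀ hs]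

/-- The `k(X)`-linear isomorphism `f ↦ f dX` from rational functions to differential forms. -/
def formEquiv (k : Type*) [Field k] : RatFunc k ≃ₗ[RatFunc k] DiffForm k :=
  LinearEquiv.ofBijective (LinearMap.toSpanSingleton (RatFunc k) (DiffForm k) (dX k))
    ⟨smul_left_injective (RatFunc k) (dX_ne_zero k), exists_eq_smul_dX⟩

theorem formEquiv_apply {k : Type*} [Field k] (f : RatFunc k) :
    formEquiv k f = f • dX k := rfl

/-- The rational function `f` with `ω = f dX`. -/
def coeff {k : Type*} [Field k] (ω : DiffForm k) : RatFunc k := (formEquiv k).symm ω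

theorem coeff_smul_dX {k : Type*} [Field k] (ω : DiffForm k) : coeff ω • dX k = ω :=
  (formEquiv k).apply_symm_apply ω

/-- The order at a finite point `a` of a nonzero differential form. -/
def ordAt {k : Type*} [Field k] (a : k) (ω : DiffForm k) : ℤ :=
  ((coeff ω).num.rootMultiplicity a : ℤ) - ((coeff ω).denom.rootMultiplicity a : ℤ)

/-- The order at `∞` of a nonzero differential form `f dX`: the order of `f(1/X)` at `0`, which
is `deg (denom f) - deg (num f)`, minus `2`. -/
def ordInfty {k : Type*} [Field k] (ω : DiffForm k) : ℤ :=
  -(coeff ω).intDegree - 2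

/-- A form is logarithmic if it is `dF / F` for some nonzero rational function `F`. -/
def IsLogarithmic {k : Type*} [Field k] (ω : DiffForm k) : Prop :=
  ∃ F : RatFunc k, F ≠ 0 ∧ ω = F⁻¹ • KaehlerDifferential.D k (RatFunc k) F

/-- `Ω` is a space `L_{m+1,n}` (where `m` and `n` are positive): an `n`-dimensional `𝔽_p`-vector
space of differential forms on the projective line whose nonzero elements are all logarithmic,
have no zero at a finite point, and have order `m - 1` at `∞`. -/
structure IsSpaceL (p : ℕ) [Fact p.Prime] {k : Type*} [Field k] [Algebra (ZMod p) k]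
    (m n : ℕ) (Ω : Submodule (ZMod p) (DiffForm k)) : Prop where
  m_pos : 0 < m
  n_pos : 0 < n
  finrank_eq : Module.finrank (ZMod p) Ω = n
  isLogarithmic : ∀ ω ∈ Ω, ω ≠ 0 → IsLogarithmic ω
  ordAt_nonpos : ∀ ω ∈ Ω, ω ≠ 0 → ∀ a : k, ordAt a ω ≤ 0
  ordInfty_eq : ∀ ω ∈ Ω, ω ≠ 0 → ordInfty ω = (m : ℤ) - 1

end

end SpacesL

namespace SpacesL

open Polynomial Matrix

/-! Let n = r + 2 and g_t = 1 + p + ⋯ + p^(t-1). Let Q have simple zeros at the set S of all poles,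
and write a basis of the space as (R_j / Q) dX, with residue vectors h(x) in 𝔽_p^n. Counting poles
gives |S| = g_n.

Moore determinants give a normal form. Modulo X - x the vector (R_j) is a multiple of h(x), so row
operations make its Moore minors highly divisible by Q, and degrees leave only Q^(g_r) (A_j X^(p^r)
+ B_j) (`exists_mooreCofactor_eq`). Taking p^r-th roots gives linear L_j with Σ h_j(x) L_j(x) = 0 at
each pole x (`exists_linear`). Hence, up to constants, Q is the Moore determinant of L and R_j its
j-th Moore minor. Only one row of these determinants does not consist of p-th powers, and it is
linear, so Q'' = 0 and R_j'' = 0.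

Therefore Q'^(p-2) (R_j Q' - R_j' Q) - R_j^p has zero derivative. It vanishes on S because h^p = h
for residues, so Q^p divides it, and its degree forces it to be 0. As p > 2, a zero of the
nonconstant polynomial Q' would be a common zero of all R_j, and there is none. -/

/-- The exponent sum `1 + p + ⋯ + p ^ (t - 1)`. -/
def geomExp (p t : ℕ) : ℕ := ∑ i ∈ Finset.range t, p ^ i

theorem geomExp_succ (p t : ℕ) : geomExp p (t + 1) = geomExp p t + p ^ t :=
  Finset.sum_range_succ _ _

theorem geomExp_succ' (p t : ℕ) : geomExp p (t + 1) = p * geomExp p t + 1 := by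
  simp [geomExp, Finset.sum_range_succ', Finset.mul_sum, pow_succ']

theorem prod_pow_pow_eq {A : Type*} [CommMonoid A] (a : A) (p t : ℕ) :
    ∏ i : Fin t, a ^ p ^ (i : ℕ) = a ^ geomExp p t := by
  rw [Finset.prod_pow_eq_pow_sum, geomExp, Finset.sum_range]

/-! ### Moore minors and their divisibility -/

section Cofactors

variable {A : Type*} [CommRing A] (p : ℕ)

/-- The matrix with rows `ℓ, y, y ^ p, …, y ^ (p ^ (s - 1))`. -/
def borderedMoore {s : ℕ} (y ℓ : Fin (s + 1) → A) : Matrix (Fin (s + 1)) (Fin (s + 1)) A :=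
  Matrix.of (Fin.cons ℓ fun (i : Fin s) j => y j ^ p ^ (i : ℕ))

/-- The signed Moore minors of `y`: the cofactors of the first row of `borderedMoore p y ℓ`. -/
def mooreCofactor {s : ℕ} (y : Fin (s + 1) → A) (j : Fin (s + 1)) : A :=
  (-1) ^ (j : ℕ) * (Matrix.of fun i l : Fin s => y (j.succAbove l) ^ p ^ (i : ℕ)).det

theorem det_borderedMoore {s : ℕ} (y ℓ : Fin (s + 1) → A) :
    (borderedMoore p y ℓ).det = ∑ j, ℓ j * mooreCofactor p y j := by
  rw [Matrix.det_succ_row_zero]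
  refine Finset.sum_congr rfl fun j _ => ?_
  rw [mooreCofactor, mul_left_comm, mul_assoc]
  rfl

theorem map_mooreCofactor {B : Type*} [CommRing B] (f : A →+* B) {s : ℕ} (y : Fin (s + 1) → A)
    (j : Fin (s + 1)) : f (mooreCofactor p y j) = mooreCofactor p (fun i => f (y i)) j := by
  simp only [mooreCofactor, map_mul, map_pow, map_neg, map_one, RingHom.map_det]
  congr 2
  ext i l
  simp

/-- If a nonzero vector is orthogonal to all rows of a bordered Moore matrix, the determinant
vanishes. -/
theorem sum_mul_mooreCofactor_eq_zero [IsDomain A] {s : ℕ} {y ℓ v : Fin (s + 1) → A} (hv : v ≠ 0)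
    (hℓ : ∑ j, ℓ j * v j = 0) (hy : ∀ i : Fin s, ∑ j, y j ^ p ^ (i : ℕ) * v j = 0) :
    ∑ j, ℓ j * mooreCofactor p y j = 0 := by
  rw [← det_borderedMoore]
  refine Matrix.exists_mulVec_eq_zero_iff.1 ⟨v, hv, ?_⟩
  ext i
  refine Fin.cases ?_ (fun i => ?_) i
  · simpa [borderedMoore, Matrix.mulVec, dotProduct] using hℓ
  · simpa [borderedMoore, Matrix.mulVec, dotProduct] using hy i

theorem pow_pow_eq_self {a : A} (ha : a ^ p = a) (i : ℕ) : a ^ p ^ i = a := by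
  induction i with
  | zero => simp
  | succ i ih => rw [pow_succ, pow_mul, ih, ha]

variable [Fact p.Prime] [CharP A p]

/-- If `y` is congruent modulo `π` to a multiple of an `𝔽_p`-vector `c`, the bordered Moore
determinant with border `c` is highly divisible by `π`. -/
theorem pow_geomExp_dvd_sum_mul_mooreCofactor {s : ℕ} {y c u : Fin (s + 1) → A} {π t : A}
    (hc : ∀ j, c j ^ p = c j) (hy : ∀ j, y j = c j * t + π * u j) :
    π ^ geomExp p s ∣ ∑ j, c j * mooreCofactor p y j := by
  rw [← det_borderedMoore]
  let w : Fin (s + 1) → A := Fin.cons 1 fun i : Fin s => π ^ p ^ (i : ℕ)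
  -- Frobenius fixes c, so subtracting t^(p^i) times the border row from row i leaves (π u)^(p^i).
  have key : (borderedMoore p y c).det =
      (Matrix.of fun i j => w i * borderedMoore p u c i j).det := by
    refine Matrix.det_eq_of_forall_row_eq_smul_add_const
      (Fin.cons 0 fun i : Fin s => t ^ p ^ (i : ℕ)) 0 rfl fun i j => ?_
    refine Fin.cases ?_ (fun i => ?_) i
    · simp [borderedMoore, w]
    · simp only [borderedMoore, w, Matrix.of_apply, Fin.cons_succ, Fin.cons_zero]
      rw [hy j, add_pow_char_pow, mul_pow, mul_pow, pow_pow_eq_self p (hc j)]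
      ring
  rw [key, Matrix.det_mul_column, Fin.prod_univ_succ]
  simp only [w, Fin.cons_zero, Fin.cons_succ, one_mul, prod_pow_pow_eq]
  exact dvd_mul_right _ _

/-- Without a border row, the last row, congruent to c t^(p^r), clears the others. This needs t
invertible and loses the factor of that row: the exponent is `geomExp p r` instead of `geomExp p (r
+ 1)`. -/
theorem pow_geomExp_dvd_mooreCofactor {r : ℕ} {y c u : Fin (r + 2) → A} {π t : A}
    (ht : IsUnit t) (hc : ∀ j, c j ^ p = c j) (hy : ∀ j, y j = c j * t + π * u j)
    (j : Fin (r + 2)) : π ^ geomExp p r ∣ mooreCofactor p y j := by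
  obtain ⟨t', ht'⟩ := ht.exists_left_inv
  refine Dvd.dvd.mul_left ?_ _
  let w : Fin (r + 1) → A := Fin.snoc (α := fun _ => A) (fun i : Fin r => π ^ p ^ (i : ℕ)) 1
  let B : Matrix (Fin (r + 1)) (Fin (r + 1)) A := fun i l =>
    Fin.lastCases (motive := fun _ => A) (y (j.succAbove l) ^ p ^ r)
      (fun i : Fin r => u (j.succAbove l) ^ p ^ (i : ℕ) -
        (t * t' ^ p ^ (r - i)) ^ p ^ (i : ℕ) *
          (π ^ (p ^ r - p ^ (i : ℕ)) * u (j.succAbove l) ^ p ^ r)) i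
  have key : (Matrix.of fun i l : Fin (r + 1) => y (j.succAbove l) ^ p ^ (i : ℕ)).det =
      (Matrix.of fun i l => w i * B i l).det := by
    refine Matrix.det_eq_of_forall_row_eq_smul_add_const
      (Fin.snoc (α := fun _ => A) (fun i : Fin r => (t * t' ^ p ^ (r - i)) ^ p ^ (i : ℕ)) 0)
      (Fin.last r) (by simp) fun i l => ?_
    refine Fin.lastCases ?_ (fun i => ?_) i
    · simp [B, w]
    · have hi : (i : ℕ) ≤ r := i.2.le
      have h1 : π ^ p ^ r = π ^ p ^ (i : ℕ) * π ^ (p ^ r - p ^ (i : ℕ)) := by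
        rw [← pow_add, Nat.add_sub_cancel' (Nat.pow_le_pow_right (Fact.out : p.Prime).pos hi)]
      have h2 : (t * t' ^ p ^ (r - i)) ^ p ^ (i : ℕ) * t ^ p ^ r = t ^ p ^ (i : ℕ) := by
        rw [mul_pow, ← pow_mul, ← pow_add, Nat.sub_add_cancel hi, mul_assoc, ← mul_pow, ht',
          one_pow, mul_one]
      simp only [B, w, Matrix.of_apply, Fin.snoc_castSucc, Fin.snoc_last, Fin.val_castSucc,
        Fin.lastCases_castSucc, Fin.lastCases_last, one_mul]
      generalize (t * t' ^ p ^ (r - i)) ^ p ^ (i : ℕ) = e at h2 ⊢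
      rw [hy, add_pow_char_pow, add_pow_char_pow, mul_pow, mul_pow, mul_pow π _ (p ^ r),
        mul_pow (c _) t (p ^ r), pow_pow_eq_self p (hc _), pow_pow_eq_self p (hc _), mul_add,
        mul_left_comm _ (c _), h2, h1]
      ring
  rw [key, Matrix.det_mul_column, Fin.prod_univ_castSucc]
  simp only [w, Fin.snoc_castSucc, Fin.snoc_last, mul_one, prod_pow_pow_eq]
  exact dvd_mul_right _ _

end Cofactors

/-! ### Nonvanishing of Moore determinants over a field -/

section Field

variable {K : Type*} [Field K] (p : ℕ) [Fact p.Prime]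

/-- An additive polynomial of `p`-degree less than `t` with `p ^ t` zeros is zero. -/
theorem eq_zero_of_additive_vanishing {t : ℕ} (c : Fin t → K) (U : Finset K) (hU : p ^ t ≤ U.card)
    (h : ∀ a ∈ U, ∑ i, c i * a ^ p ^ (i : ℕ) = 0) : c = 0 := by
  cases t with
  | zero => exact Subsingleton.elim _ _
  | succ t =>
    have hp := (Fact.out : p.Prime)
    let E : K[X] := ∑ i, C (c i) * X ^ p ^ (i : ℕ)
    have hE : E = 0 := by
      refine Polynomial.eq_zero_of_natDegree_lt_card_of_eval_eq_zero' E U (fun a ha => ?_) ?_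
      · simpa [E, eval_finsetSum] using h a ha
      · refine lt_of_lt_of_le (lt_of_le_of_lt ?_ (Nat.pow_lt_pow_right hp.one_lt t.lt_succ_self)) hU
        refine natDegree_sum_le_of_forall_le _ _ fun i _ => ?_
        refine (natDegree_C_mul_X_pow_le _ _).trans (Nat.pow_le_pow_right hp.pos ?_)
        exact Nat.lt_succ_iff.1 i.2
    ext i
    have h2 := congrArg (fun q => q.coeff (p ^ (i : ℕ))) hE
    simp only [E, finsetSum_coeff, coeff_C_mul_X_pow, coeff_zero] at h2
    rw [Finset.sum_eq_single i] at h2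
    · simpa using h2
    · intro b _ hb
      rw [if_neg]
      intro h3
      exact hb (Fin.ext (Nat.pow_right_injective hp.two_le h3.symm))
    · simp

variable [Algebra (ZMod p) K]

/-- The pairing of an `𝔽_p`-vector with a family in `K`. -/
def pairing {n : ℕ} (α : Fin n → K) : (Fin n → ZMod p) →ₗ[ZMod p] K :=
  Fintype.linearCombination (ZMod p) α

theorem pairing_apply {n : ℕ} (α : Fin n → K) (u : Fin n → ZMod p) :
    pairing p α u = ∑ j, algebraMap (ZMod p) K (u j) * α j := by
  simp [pairing, Fintype.linearCombination_apply, Algebra.smul_def]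

theorem card_ker_dotProduct {s : ℕ} {ℓ : Fin (s + 1) → ZMod p} (hℓ : ℓ ≠ 0) :
    (Finset.univ.filter fun u => ℓ ⬝ᵥ u = 0).card = p ^ s := by
  classical
  let f : (Fin (s + 1) → ZMod p) →ₗ[ZMod p] ZMod p := dotProductBilin (ZMod p) (ZMod p) ℓ
  have hf : Function.Surjective f := by
    obtain ⟨j, hj⟩ := Function.ne_iff.1 hℓ
    intro a
    refine ⟨Pi.single j ((ℓ j)⁻¹ * a), ?_⟩
    simp only [f, dotProductBilin_apply_apply, dotProduct_single]
    exact mul_inv_cancel_left₀ hj a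
  have h1 := f.finrank_range_add_finrank_ker
  rw [LinearMap.range_eq_top.2 hf, finrank_top, Module.finrank_self, Module.finrank_fin_fun] at h1
  have h2 : Module.finrank (ZMod p) (LinearMap.ker f) = s := by omega
  have h3 := Module.card_eq_pow_finrank (K := ZMod p) (V := LinearMap.ker f)
  rw [h2, ZMod.card] at h3
  rw [← h3, Fintype.card_subtype]
  congr 1
  ext u
  simp [f]

theorem algebraMap_zmod_pow (a : ZMod p) (i : ℕ) :
    algebraMap (ZMod p) K a ^ p ^ i = algebraMap (ZMod p) K a := by
  rw [← map_pow, ZMod.pow_card_pow]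

variable [CharP K p]

theorem sum_mul_pairing_pow {n t : ℕ} (c : Fin t → K) (α : Fin n → K) (u : Fin n → ZMod p) :
    ∑ i, c i * pairing p α u ^ p ^ (i : ℕ) =
      ∑ j, algebraMap (ZMod p) K (u j) * ∑ i, c i * α j ^ p ^ (i : ℕ) := by
  simp_rw [pairing_apply, sum_pow_char_pow, mul_pow, algebraMap_zmod_pow, Finset.mul_sum]
  rw [Finset.sum_comm]
  simp_rw [mul_left_comm]

/-- The Moore determinant of an `𝔽_p`-independent family is nonzero. -/
theorem moore_ne_zero {s : ℕ} {α : Fin (s + 1) → K}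
    (hα : Function.Injective (pairing p α)) :
    ∑ j, α j * mooreCofactor p (fun i => α i ^ p) j ≠ 0 := by
  classical
  rw [← det_borderedMoore]
  intro h0
  -- A relation between the rows is an additive polynomial killing each α j, hence all p^(s+1)
  -- points of their 𝔽_p-span.
  obtain ⟨c, hc, hc0⟩ := Matrix.exists_vecMul_eq_zero_iff.2 h0
  have hrow : ∀ j, ∑ i, c i * α j ^ p ^ (i : ℕ) = 0 := fun j => by
    have := congrFun hc0 j
    simpa [Matrix.vecMul, dotProduct, borderedMoore, Fin.sum_univ_succ, ← pow_mul, ← pow_succ']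
      using this
  refine hc (eq_zero_of_additive_vanishing p c
    (Finset.univ.image (pairing p α)) ?_ ?_)
  · rw [Finset.card_image_of_injective _ hα]
    simp [ZMod.card]
  · intro a ha
    obtain ⟨u, -, rfl⟩ := Finset.mem_image.1 ha
    rw [sum_mul_pairing_pow]
    simp [hrow]

/-- A row relation of the bordered matrix gives an additive polynomial proportional to ℓ on the α j.
It vanishes on the image of the hyperplane orthogonal to ℓ, which has p^s points, too many for its
degree. -/
theorem sum_algebraMap_mul_mooreCofactor_ne_zero {s : ℕ} {α : Fin (s + 1) → K}
    (hα : Function.Injective (pairing p α)) {ℓ : Fin (s + 1) → ZMod p} (hℓ : ℓ ≠ 0) :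
    ∑ j, algebraMap (ZMod p) K (ℓ j) * mooreCofactor p α j ≠ 0 := by
  classical
  rw [← det_borderedMoore p α fun j => algebraMap (ZMod p) K (ℓ j)]
  intro h0
  obtain ⟨c, hc, hc0⟩ := Matrix.exists_vecMul_eq_zero_iff.2 h0
  have hrow : ∀ j, c 0 * algebraMap (ZMod p) K (ℓ j) +
      ∑ i : Fin s, c i.succ * α j ^ p ^ (i : ℕ) = 0 := fun j => by
    have := congrFun hc0 j
    simpa [Matrix.vecMul, dotProduct, borderedMoore, Fin.sum_univ_succ] using this
  have hc1 : (fun i : Fin s => c i.succ) = 0 := by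
    refine eq_zero_of_additive_vanishing p _
      ((Finset.univ.filter fun u => ℓ ⬝ᵥ u = 0).image (pairing p α)) ?_ ?_
    · rw [Finset.card_image_of_injective _ hα, card_ker_dotProduct p hℓ]
    · intro a ha
      obtain ⟨u, hu, rfl⟩ := Finset.mem_image.1 ha
      rw [Finset.mem_filter] at hu
      rw [sum_mul_pairing_pow]
      have h4 : ∀ j, ∑ i : Fin s, c i.succ * α j ^ p ^ (i : ℕ) =
          -(c 0 * algebraMap (ZMod p) K (ℓ j)) := fun j => eq_neg_of_add_eq_zero_right (hrow j)
      simp_rw [h4, mul_neg, mul_left_comm _ (c 0), Finset.sum_neg_distrib, ← Finset.mul_sum,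
        mul_comm (algebraMap (ZMod p) K (u _)), ← map_mul, ← map_sum]
      rw [show ∑ j, ℓ j * u j = 0 from hu.2]
      simp
  apply hc
  obtain ⟨j, hj⟩ := Function.ne_iff.1 hℓ
  have h5 := hrow j
  have h6 : ∀ i : Fin s, c i.succ = 0 := fun i => congrFun hc1 i
  simp only [h6, zero_mul, Finset.sum_const_zero, add_zero, mul_eq_zero, map_eq_zero] at h5
  ext i
  refine Fin.cases (h5.resolve_right hj) h6 i

end Field

/-! ### Degrees, leading coefficients and derivatives of Moore minors -/

section Polys

variable {A : Type*} [CommRing A] (p : ℕ)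

theorem coeff_prod_of_natDegree_le_sum {ι : Type*} (s : Finset ι) (f : ι → A[X]) (d : ι → ℕ)
    (h : ∀ i ∈ s, (f i).natDegree ≤ d i) :
    (∏ i ∈ s, f i).coeff (∑ i ∈ s, d i) = ∏ i ∈ s, (f i).coeff (d i) := by
  classical
  induction s using Finset.induction_on with
  | empty => simp
  | insert a s ha ih =>
    rw [Finset.prod_insert ha, Finset.sum_insert ha, Finset.prod_insert ha,
      ← ih fun i hi => h i (Finset.mem_insert_of_mem hi)]
    refine coeff_mul_add_eq_of_natDegree_le (h a (Finset.mem_insert_self _ _)) ?_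
    exact (natDegree_prod_le _ _).trans
      (Finset.sum_le_sum fun i hi => h i (Finset.mem_insert_of_mem hi))

theorem natDegree_det_le_sum {m : ℕ} (M : Matrix (Fin m) (Fin m) A[X]) (d : Fin m → ℕ)
    (h : ∀ i j, (M i j).natDegree ≤ d i) : M.det.natDegree ≤ ∑ i, d i := by
  rw [Matrix.det_apply']
  refine natDegree_sum_le_of_forall_le _ _ fun σ _ => ?_
  rw [← Polynomial.C_eq_intCast]
  refine (natDegree_C_mul_le _ _).trans ((natDegree_prod_le _ _).trans ?_)
  rw [← Equiv.sum_comp σ d]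
  exact Finset.sum_le_sum fun i _ => h _ _

theorem coeff_det_sum {m : ℕ} (M : Matrix (Fin m) (Fin m) A[X]) (d : Fin m → ℕ)
    (h : ∀ i j, (M i j).natDegree ≤ d i) :
    M.det.coeff (∑ i, d i) = (Matrix.of fun i j => (M i j).coeff (d i)).det := by
  rw [Matrix.det_apply', Matrix.det_apply', finsetSum_coeff]
  refine Finset.sum_congr rfl fun σ _ => ?_
  rw [← Polynomial.C_eq_intCast, coeff_C_mul, ← Equiv.sum_comp σ d,
    coeff_prod_of_natDegree_le_sum _ _ _ fun i _ => h _ _]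
  rfl

theorem sum_mul_pow_eq (p e s : ℕ) : ∑ i : Fin s, p ^ (i : ℕ) * e = geomExp p s * e := by
  rw [← Finset.sum_mul, geomExp, Finset.sum_range]

theorem natDegree_mooreCofactor_le {s e : ℕ} {y : Fin (s + 1) → A[X]}
    (hy : ∀ j, (y j).natDegree ≤ e) (j : Fin (s + 1)) :
    (mooreCofactor p y j).natDegree ≤ geomExp p s * e := by
  have : ((-1 : A[X]) ^ (j : ℕ)) = C ((-1) ^ (j : ℕ)) := by simp
  rw [mooreCofactor, this, ← sum_mul_pow_eq]
  refine (natDegree_C_mul_le _ _).trans (natDegree_det_le_sum _ _ fun i l => ?_)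
  exact natDegree_pow_le_of_le _ (hy _)

theorem coeff_mooreCofactor {s e : ℕ} {y : Fin (s + 1) → A[X]}
    (hy : ∀ j, (y j).natDegree ≤ e) (j : Fin (s + 1)) :
    (mooreCofactor p y j).coeff (geomExp p s * e) =
      mooreCofactor p (fun i => (y i).coeff e) j := by
  have : ((-1 : A[X]) ^ (j : ℕ)) = C ((-1) ^ (j : ℕ)) := by simp
  rw [mooreCofactor, this, ← sum_mul_pow_eq, coeff_C_mul, coeff_det_sum, mooreCofactor]
  · congr 2
    ext i l
    simp only [Matrix.of_apply]
    exact coeff_pow_of_natDegree_le (hy _)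
  · exact fun i l => natDegree_pow_le_of_le _ (hy _)

theorem derivative_prod_eq_zero {ι : Type*} (s : Finset ι) (f : ι → A[X])
    (h : ∀ i ∈ s, derivative (f i) = 0) : derivative (∏ i ∈ s, f i) = 0 :=
  Finset.prod_induction f (fun q => derivative q = 0)
    (fun a b ha hb => by simp [ha, hb]) (by simp) h

theorem derivative_det_eq_zero {m : ℕ} (M : Matrix (Fin m) (Fin m) A[X])
    (h : ∀ i j, derivative (M i j) = 0) : derivative M.det = 0 := by
  rw [Matrix.det_apply', derivative_sum]
  refine Finset.sum_eq_zero fun σ _ => ?_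
  rw [← Polynomial.C_eq_intCast, derivative_C_mul, derivative_prod_eq_zero _ _ fun i _ => h _ _,
    mul_zero]

theorem derivative_mooreCofactor_eq_zero {s : ℕ} {y : Fin (s + 1) → A[X]}
    (h : ∀ j, derivative (y j) = 0) (j : Fin (s + 1)) : derivative (mooreCofactor p y j) = 0 := by
  have : ((-1 : A[X]) ^ (j : ℕ)) = C ((-1) ^ (j : ℕ)) := by simp
  rw [mooreCofactor, this, derivative_C_mul, derivative_det_eq_zero, mul_zero]
  intro i l
  simp [derivative_pow, h]

/-- The Moore minors of a family of linear polynomials have vanishing second derivative. -/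
theorem derivative_derivative_mooreCofactor [CharP A p] {r : ℕ} {y : Fin (r + 2) → A[X]}
    (h : ∀ j, derivative (derivative (y j)) = 0) (j : Fin (r + 2)) :
    derivative (derivative (mooreCofactor p y j)) = 0 := by
  have : ((-1 : A[X]) ^ (j : ℕ)) = C ((-1) ^ (j : ℕ)) := by simp
  rw [mooreCofactor, this, derivative_C_mul, derivative_C_mul, Matrix.det_succ_row_zero,
    derivative_sum, derivative_sum, Finset.sum_eq_zero, mul_zero]
  intro l _
  have h2 : ((-1 : A[X]) ^ (l : ℕ)) = C ((-1) ^ (l : ℕ)) := by simp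
  -- Every row but the first consists of p-th powers.
  have h3 : derivative ((Matrix.of fun i l : Fin (r + 1) =>
      y (j.succAbove l) ^ p ^ (i : ℕ)).submatrix Fin.succ l.succAbove).det = 0 := by
    refine derivative_det_eq_zero _ fun i l => ?_
    simp [derivative_pow]
  rw [h2, mul_assoc, derivative_C_mul, derivative_C_mul, derivative_mul, h3, mul_zero, add_zero,
    derivative_mul, h3, mul_zero, add_zero]
  simp [h]

end Polys

/-! ### Polynomials with prescribed zeros, and pole configurations -/

section Config

variable {k : Type*} [Field k]

/-- The monic polynomial with simple zeros at the points of `S`. -/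
noncomputable abbrev zeroPoly (S : Finset k) : k[X] := Lagrange.nodal S id

theorem eval_derivative_zeroPoly_ne_zero [DecidableEq k] {S : Finset k} {x : k} (hx : x ∈ S) :
    (derivative (zeroPoly S)).eval x ≠ 0 := by
  have := Lagrange.eval_nodal_derivative_eval_node_eq (v := id) hx
  rw [id] at this
  rw [this, Lagrange.eval_nodal, Finset.prod_ne_zero_iff]
  intro y hy
  rw [sub_ne_zero]
  exact (Finset.ne_of_mem_erase hy).symm

theorem prod_X_sub_C_pow_dvd {S : Finset k} {e : ℕ} {f : k[X]}
    (h : ∀ x ∈ S, (X - C x) ^ e ∣ f) : zeroPoly S ^ e ∣ f := by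
  rw [zeroPoly, Lagrange.nodal_eq, ← Finset.prod_pow]
  refine Finset.prod_dvd_of_coprime (fun x _ y _ hxy => ?_) h
  exact (pairwise_coprime_X_sub_C Function.injective_id hxy).pow

theorem zeroPoly_dvd {S : Finset k} {f : k[X]} (h : ∀ x ∈ S, f.eval x = 0) : zeroPoly S ∣ f := by
  rw [← pow_one (zeroPoly S)]
  exact prod_X_sub_C_pow_dvd fun x hx => by rw [pow_one]; exact dvd_iff_isRoot.2 (h x hx)

theorem eq_C_mul_of_monic_of_dvd {f g : k[X]} (hg : g.Monic) (hdvd : g ∣ f)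
    (hdeg : f.natDegree ≤ g.natDegree) : ∃ c, f = C c * g :=
  ⟨_, eq_leadingCoeff_mul_of_monic_of_dvd_of_natDegree_le hg hdvd hdeg⟩

/-- If `f` has vanishing derivative, then its zeros have multiplicity at least `p`. -/
theorem X_sub_C_pow_char_dvd (p : ℕ) [Fact p.Prime] [CharP k p] {f : k[X]} {x : k}
    (hf : derivative f = 0) (hx : f.eval x = 0) : (X - C x) ^ p ∣ f := by
  have hp := (Fact.out : p.Prime)
  rw [← expand_contract p hf hp.ne_zero] at hx ⊢
  rw [expand_eval] at hx
  have := map_dvd (expand k p) (dvd_iff_isRoot.2 hx)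
  rw [sub_pow_char, ← C_pow]
  simpa using this

variable (p : ℕ) [Fact p.Prime] [Algebra (ZMod p) k]

theorem C_algebraMap_pow (a : ZMod p) :
    (C (algebraMap (ZMod p) k a)) ^ p = C (algebraMap (ZMod p) k a) := by
  have := algebraMap_zmod_pow (K := k) p a 1
  rw [pow_one] at this
  rw [← C_pow, this]

/-- The poles `S`, residue vectors `h` and numerators `R` of a basis of a space `L_{p^(r+1),r+2}`,
written over the common denominator `zeroPoly S`. -/
structure IsPoleConfig [DecidableEq k] {r : ℕ} (S : Finset k) (h : k → Fin (r + 2) → ZMod p)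
    (R : Fin (r + 2) → k[X]) : Prop where
  eval_eq : ∀ x ∈ S, ∀ j,
    (R j).eval x = algebraMap (ZMod p) k (h x j) * (derivative (zeroPoly S)).eval x
  factor : ∀ u : Fin (r + 2) → ZMod p, u ≠ 0 → ∃ a : k, a ≠ 0 ∧
    ∑ j, C (algebraMap (ZMod p) k (u j)) * R j = C a * zeroPoly (S.filter fun x => h x ⬝ᵥ u = 0)
  card_filter : ∀ u : Fin (r + 2) → ZMod p, u ≠ 0 →
    (S.filter fun x => h x ⬝ᵥ u ≠ 0).card = p ^ (r + 1)
  ne_zero : ∀ x ∈ S, h x ≠ 0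

namespace IsPoleConfig

variable {p} [DecidableEq k] {r : ℕ} {S : Finset k} {h : k → Fin (r + 2) → ZMod p}
  {R : Fin (r + 2) → k[X]}

/-- Double counting of pairs (u, x) with h x ⬝ᵥ u ≠ 0: (p^(r+2) - 1) p^(r+1) = |S| (p^(r+2) -
p^(r+1)). -/
theorem card_eq (H : IsPoleConfig p S h R) : S.card = geomExp p (r + 2) := by
  have hp := (Fact.out : p.Prime)
  have h1 := Finset.sum_card_bipartiteAbove_eq_sum_card_bipartiteBelow
    (s := (Finset.univ : Finset (Fin (r + 2) → ZMod p)).erase 0) (t := S)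
    (fun u x => h x ⬝ᵥ u ≠ 0)
  simp only [Finset.bipartiteAbove, Finset.bipartiteBelow] at h1
  rw [Finset.sum_congr rfl fun u hu => H.card_filter u (Finset.ne_of_mem_erase hu),
    Finset.sum_const, smul_eq_mul, Finset.card_erase_of_mem (Finset.mem_univ _), Finset.card_univ,
    Fintype.card_fun, ZMod.card, Fintype.card_fin] at h1
  have h2 : ∀ x ∈ S, (((Finset.univ : Finset (Fin (r + 2) → ZMod p)).erase 0).filter
      fun u => h x ⬝ᵥ u ≠ 0).card + p ^ (r + 1) = p ^ (r + 2) := by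
    intro x hx
    rw [← card_ker_dotProduct p (H.ne_zero x hx)]
    have h3 : ((Finset.univ : Finset (Fin (r + 2) → ZMod p)).erase 0).filter
        (fun u => h x ⬝ᵥ u ≠ 0) = Finset.univ.filter fun u => ¬ h x ⬝ᵥ u = 0 := by
      ext u
      simp only [Finset.mem_filter, Finset.mem_erase, Finset.mem_univ, and_true, true_and,
        and_iff_right_iff_imp]
      rintro hu rfl
      exact hu (dotProduct_zero _)
    rw [h3, add_comm, Finset.card_filter_add_card_filter_not, Finset.card_univ,
      Fintype.card_fun, ZMod.card, Fintype.card_fin]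
  have h4 := Finset.sum_congr (rfl : S = S) h2
  rw [Finset.sum_add_distrib, ← h1, Finset.sum_const, Finset.sum_const, smul_eq_mul,
    smul_eq_mul] at h4
  have h5 : p * geomExp p (r + 2) + 1 = geomExp p (r + 2) + p ^ (r + 2) := by
    rw [← geomExp_succ', geomExp_succ]
  have h6 : 0 < p ^ (r + 2) := pow_pos hp.pos _
  have h7 : p ^ (r + 2) = p ^ (r + 1) * p := pow_succ _ _
  obtain ⟨P, hP⟩ : ∃ P, p = P + 2 := ⟨p - 2, (Nat.sub_add_cancel hp.two_le).symm⟩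
  have h8 : p ^ (r + 2) - 1 = (P + 1) * geomExp p (r + 2) := by
    have : p * geomExp p (r + 2) = (P + 1) * geomExp p (r + 2) + geomExp p (r + 2) := by
      nth_rewrite 1 [hP]; ring
    omega
  rw [h8, h7] at h4
  have h9 : ((P + 1) * p ^ (r + 1)) * geomExp p (r + 2) = ((P + 1) * p ^ (r + 1)) * S.card := by
    have : S.card * (p ^ (r + 1) * p) =
        ((P + 1) * p ^ (r + 1)) * S.card + S.card * p ^ (r + 1) := by
      nth_rewrite 2 [hP]; ring
    rw [this] at h4
    linarith
  exact (Nat.eq_of_mul_eq_mul_left (by have := hp.pos; positivity) h9).symm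

theorem card_filter_eq_zero (H : IsPoleConfig p S h R) {u : Fin (r + 2) → ZMod p} (hu : u ≠ 0) :
    (S.filter fun x => h x ⬝ᵥ u = 0).card = geomExp p (r + 1) := by
  have h1 := S.card_filter_add_card_filter_not fun x => h x ⬝ᵥ u = 0
  have h2 : (S.filter fun x => ¬ h x ⬝ᵥ u = 0).card = p ^ (r + 1) := H.card_filter u hu
  rw [H.card_eq, h2, geomExp_succ] at h1
  exact Nat.add_right_cancel h1

/-- Otherwise some u ≠ 0 is orthogonal to all residue vectors, and its form would have no pole. -/
theorem span_eq_top (H : IsPoleConfig p S h R) : Submodule.span (ZMod p) (h '' S) = ⊤ := by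
  by_contra hne
  obtain ⟨f, hf, hle⟩ := Submodule.exists_le_ker_of_lt_top _ (lt_top_iff_ne_top.2 hne)
  let u : Fin (r + 2) → ZMod p := fun j => f (Pi.single j 1)
  have hfu : ∀ v, f v = v ⬝ᵥ u := fun v => by
    conv_lhs => rw [pi_eq_sum_univ' v, map_sum]
    simp [dotProduct, u]
  have hu : u ≠ 0 := by
    rintro h0
    exact hf (LinearMap.ext fun v => by simp [hfu, h0])
  have h1 := H.card_filter u hu
  rw [Finset.filter_false_of_mem, Finset.card_empty] at h1
  · exact (pow_pos (Fact.out : p.Prime).pos _).ne h1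
  · intro x hx
    rw [not_not, ← hfu]
    exact hle (Submodule.subset_span ⟨x, hx, rfl⟩)

theorem single_factor (H : IsPoleConfig p S h R) (j : Fin (r + 2)) : ∃ a : k, a ≠ 0 ∧
    R j = C a * zeroPoly (S.filter fun x => h x j = 0) := by
  obtain ⟨a, ha, h1⟩ := H.factor (Pi.single j 1) (by simp)
  refine ⟨a, ha, ?_⟩
  rw [Finset.sum_eq_single j (fun i _ hi => by simp [hi]) (by simp)] at h1
  simpa using h1

theorem card_filter_single (H : IsPoleConfig p S h R) (j : Fin (r + 2)) :
    (S.filter fun x => h x j = 0).card = geomExp p (r + 1) := by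
  simpa using H.card_filter_eq_zero (u := Pi.single j 1) (by simp)

theorem natDegree_le (H : IsPoleConfig p S h R) (j : Fin (r + 2)) :
    (R j).natDegree ≤ geomExp p (r + 1) := by
  obtain ⟨a, -, h1⟩ := H.single_factor j
  rw [h1]
  refine (natDegree_C_mul_le _ _).trans ?_
  rw [Lagrange.natDegree_nodal, H.card_filter_single]

/-- All nonzero 𝔽_p-combinations of the numerators have the same exact degree, so their top
coefficients cannot cancel. -/
theorem pairing_coeff_injective (H : IsPoleConfig p S h R) :
    Function.Injective (pairing p fun j => (R j).coeff (geomExp p (r + 1))) := by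
  rw [injective_iff_map_eq_zero]
  intro u hu
  by_contra hu0
  obtain ⟨a, ha, h1⟩ := H.factor u hu0
  have h2 := congrArg (fun q => q.coeff (geomExp p (r + 1))) h1
  simp only [finsetSum_coeff, coeff_C_mul] at h2
  rw [← pairing_apply, hu, ← H.card_filter_eq_zero hu0] at h2
  have h3 := (Lagrange.nodal_monic (s := S.filter fun x => h x ⬝ᵥ u = 0) (v := id)).coeff_natDegree
  rw [Lagrange.natDegree_nodal] at h3
  rw [h3, mul_one] at h2
  exact ha h2.symm

theorem exists_eval_ne_zero (H : IsPoleConfig p S h R) (y : k) : ∃ i, (R i).eval y ≠ 0 := by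
  by_contra! hy
  have h1 : ∀ j, y ∈ S ∧ h y j = 0 := fun j => by
    obtain ⟨a, ha, h1⟩ := H.single_factor j
    have h2 := hy j
    rw [h1, eval_mul, eval_C, mul_eq_zero, Lagrange.eval_nodal, Finset.prod_eq_zero_iff] at h2
    obtain ⟨x, hx, h3⟩ := h2.resolve_left ha
    rw [id, sub_eq_zero] at h3
    simpa [h3] using hx
  exact H.ne_zero y (h1 0).1 (funext fun j => (h1 j).2)

theorem exists_decomp (H : IsPoleConfig p S h R) {x : k} (hx : x ∈ S) :
    ∃ u : Fin (r + 2) → k[X], ∀ j, R j = C (algebraMap (ZMod p) k (h x j)) *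
      C ((derivative (zeroPoly S)).eval x) + (X - C x) * u j := by
  have h1 : ∀ j, ∃ u, R j - C ((R j).eval x) = (X - C x) * u := fun j => X_sub_C_dvd_sub_C_eval
  choose u hu using h1
  refine ⟨u, fun j => ?_⟩
  rw [← hu, H.eval_eq x hx, C_mul]
  ring

variable [CharP k p]

theorem zeroPoly_pow_dvd_mooreCofactor (H : IsPoleConfig p S h R) (j : Fin (r + 2)) :
    zeroPoly S ^ geomExp p r ∣ mooreCofactor p R j := by
  refine prod_X_sub_C_pow_dvd fun x hx => ?_
  obtain ⟨u, hu⟩ := H.exists_decomp hx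
  exact pow_geomExp_dvd_mooreCofactor p
    (isUnit_C.2 (eval_derivative_zeroPoly_ne_zero hx).isUnit) (fun j => C_algebraMap_pow p _) hu j

/-- The degree bound for the Moore minors of R exceeds the degree of Q^(g_r) by exactly p^r. -/
theorem geomExp_identity (p r : ℕ) :
    geomExp p r * geomExp p (r + 2) + p ^ r = geomExp p (r + 1) * geomExp p (r + 1) := by
  have h1 := geomExp_succ p r
  have h2 := geomExp_succ' p r
  have h3 := geomExp_succ' p (r + 1)
  rw [h3]
  generalize geomExp p (r + 1) = d at *
  generalize geomExp p r = g at *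
  generalize p ^ r = q at *
  have : d * d = d * g + d * q := by rw [← mul_add, ← h1]
  rw [this]
  nth_rewrite 2 [h2]
  rw [h1]
  have h4 : g * p * q + q = d * q := by rw [h2]; ring
  nlinarith [h4]

/-- Residue vectors are sent to `(X - x) ^ p ^ r` by the Moore minors, up to a fixed factor. -/
theorem sum_mul_mooreCofactor_eq (H : IsPoleConfig p S h R) {x : k} (hx : x ∈ S) :
    ∃ c, ∑ j, C (algebraMap (ZMod p) k (h x j)) * mooreCofactor p R j =
      C c * (zeroPoly S ^ geomExp p r * (X - C x) ^ p ^ r) := by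
  have hm : (zeroPoly S ^ geomExp p r * (X - C x) ^ p ^ r).Monic :=
    (Lagrange.nodal_monic.pow _).mul ((monic_X_sub_C x).pow _)
  refine eq_C_mul_of_monic_of_dvd hm ?_ ?_
  · have h1 : zeroPoly S = (X - C x) * zeroPoly (S.erase x) :=
      Lagrange.nodal_eq_mul_nodal_erase (v := id) hx
    rw [h1, mul_pow, mul_right_comm, ← pow_add, ← geomExp_succ]
    -- At x the border improves the exponent from g_r to g_(r+1) = g_r + p^r; at the other poles the
    -- bound for single minors suffices.
    refine IsCoprime.mul_dvd ?_ ?_ ?_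
    · refine IsCoprime.pow ?_
      refine IsCoprime.prod_right fun y hy => ?_
      exact pairwise_coprime_X_sub_C Function.injective_id (Finset.ne_of_mem_erase hy).symm
    · obtain ⟨u, hu⟩ := H.exists_decomp hx
      exact pow_geomExp_dvd_sum_mul_mooreCofactor p (fun j => C_algebraMap_pow p _) hu
    · refine Finset.dvd_sum fun j _ => Dvd.dvd.mul_left ?_ _
      refine dvd_trans ?_ (H.zeroPoly_pow_dvd_mooreCofactor j)
      exact pow_dvd_pow_of_dvd (h1 ▸ dvd_mul_left _ _) _
  · rw [Monic.natDegree_mul (Lagrange.nodal_monic.pow _) ((monic_X_sub_C x).pow _),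
      natDegree_pow, natDegree_pow, natDegree_X_sub_C, Lagrange.natDegree_nodal, H.card_eq,
      mul_one, geomExp_identity]
    refine natDegree_sum_le_of_forall_le _ _ fun j _ => (natDegree_C_mul_le _ _).trans ?_
    exact natDegree_mooreCofactor_le p H.natDegree_le j

theorem exists_mooreCofactor_eq (H : IsPoleConfig p S h R) : ∃ A B : Fin (r + 2) → k, ∀ j,
    mooreCofactor p R j = zeroPoly S ^ geomExp p r * (C (A j) * X ^ p ^ r + C (B j)) := by
  have key : ∀ v : Fin (r + 2) → ZMod p, ∃ A B : k,
      ∑ j, C (algebraMap (ZMod p) k (v j)) * mooreCofactor p R j =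
        zeroPoly S ^ geomExp p r * (C A * X ^ p ^ r + C B) := by
    intro v
    -- The claim is linear in v, and for residue vectors it is the previous lemma.
    have hv : v ∈ Submodule.span (ZMod p) (h '' S) := H.span_eq_top ▸ Submodule.mem_top
    induction hv using Submodule.span_induction with
    | mem v hv =>
      obtain ⟨x, hx, rfl⟩ := hv
      obtain ⟨c, hc⟩ := H.sum_mul_mooreCofactor_eq hx
      refine ⟨c, -(c * x ^ p ^ r), ?_⟩
      rw [hc, sub_pow_char_pow, C_neg, C_mul, C_pow]
      ring
    | zero => exact ⟨0, 0, by simp⟩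
    | add v w _ _ hv hw =>
      obtain ⟨A, B, h1⟩ := hv
      obtain ⟨A', B', h2⟩ := hw
      refine ⟨A + A', B + B', ?_⟩
      simp only [Pi.add_apply, map_add, add_mul, Finset.sum_add_distrib, h1, h2]
      ring
    | smul c v _ hv =>
      obtain ⟨A, B, h1⟩ := hv
      refine ⟨algebraMap (ZMod p) k c * A, algebraMap (ZMod p) k c * B, ?_⟩
      simp only [Pi.smul_apply, smul_eq_mul, map_mul, mul_assoc, ← Finset.mul_sum, h1]
      ring
  choose A B hAB using fun j => key (Pi.single j 1)
  refine ⟨A, B, fun j => ?_⟩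
  rw [← hAB, Finset.sum_eq_single j (fun i _ hi => by simp [hi]) (by simp)]
  simp

/-- The poles are the zeros of the `𝔽_p`-combinations of a family of linear polynomials. -/
theorem exists_linear [IsAlgClosed k] (H : IsPoleConfig p S h R) : ∃ α β : Fin (r + 2) → k,
    Function.Injective (pairing p α) ∧
      ∀ x ∈ S, ∑ j, algebraMap (ZMod p) k (h x j) * (α j * x + β j) = 0 := by
  have hq : 0 < p ^ r := pow_pos (Fact.out : p.Prime).pos _
  obtain ⟨A, B, hAB⟩ := H.exists_mooreCofactor_eq
  choose α hα using fun j => IsAlgClosed.exists_pow_nat_eq (A j) hq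
  choose β hβ using fun j => IsAlgClosed.exists_pow_nat_eq (B j) hq
  have hQ0 : zeroPoly S ^ geomExp p r ≠ 0 := pow_ne_zero _ Lagrange.nodal_ne_zero
  refine ⟨α, β, ?_, fun x hx => ?_⟩
  -- Comparison of top coefficients: the A j are the Moore minors of an 𝔽_p-independent family.
  · have hA : ∀ j, mooreCofactor p (fun j => (R j).coeff (geomExp p (r + 1))) j = A j := by
      intro j
      rw [← coeff_mooreCofactor p H.natDegree_le, hAB, ← geomExp_identity,
        coeff_mul_add_eq_of_natDegree_le]
      · have h1 := ((Lagrange.nodal_monic (s := S) (v := id)).pow (geomExp p r)).coeff_natDegree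
        rw [natDegree_pow, Lagrange.natDegree_nodal, H.card_eq] at h1
        rw [h1, coeff_add, coeff_C_mul, coeff_X_pow_self, coeff_C_of_ne_zero hq.ne']
        ring
      · rw [natDegree_pow, Lagrange.natDegree_nodal, H.card_eq]
      · compute_degree
    rw [injective_iff_map_eq_zero]
    intro u hu
    by_contra hu0
    refine sum_algebraMap_mul_mooreCofactor_ne_zero p H.pairing_coeff_injective hu0 ?_
    simp_rw [hA, ← hα]
    have h2 := congrArg (fun a => a ^ p ^ r) hu
    simp only [pairing_apply, sum_pow_char_pow, mul_pow, algebraMap_zmod_pow] at h2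
    rw [h2, zero_pow hq.ne']
  · obtain ⟨c, hc⟩ := H.sum_mul_mooreCofactor_eq hx
    simp_rw [hAB, mul_left_comm _ (zeroPoly S ^ geomExp p r), ← Finset.mul_sum] at hc
    have h1 := congrArg (eval x) (mul_left_cancel₀ hQ0 hc)
    simp only [eval_finsetSum, eval_mul, eval_add, eval_C, eval_pow, eval_X, eval_sub, sub_self,
      zero_pow hq.ne', mul_zero] at h1
    refine (pow_eq_zero_iff hq.ne').1 ?_
    rw [sum_pow_char_pow, ← h1]
    refine Finset.sum_congr rfl fun j _ => ?_
    rw [mul_pow, algebraMap_zmod_pow, add_pow_char_pow, mul_pow, hα, hβ]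

/-- Up to nonzero constants, the denominator is the Moore determinant of the linear family and the
numerators are its Moore minors. -/
theorem derivative_derivative_eq_zero [IsAlgClosed k] (H : IsPoleConfig p S h R) :
    derivative (derivative (zeroPoly S)) = 0 ∧ ∀ j, derivative (derivative (R j)) = 0 := by
  have hp := (Fact.out : p.Prime)
  obtain ⟨α, β, hα, hroot⟩ := H.exists_linear
  let L : Fin (r + 2) → k[X] := fun j => C (α j) * X + C (β j)
  have hLdeg : ∀ j, (L j).natDegree ≤ 1 := fun j => natDegree_linear_le
  have hLcoeff : ∀ j, (L j).coeff 1 = α j := fun j => by simp [L, coeff_C]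
  have hLeval : ∀ j x, (L j).eval x = α j * x + β j := fun j x => by simp [L]
  have hvec : ∀ x ∈ S, (fun j => algebraMap (ZMod p) k (h x j)) ≠ 0 := fun x hx h0 =>
    H.ne_zero x hx (funext fun j => by simpa using congrFun h0 j)
  -- Frobenius powers of the linear relation: h x lies in the kernel of every Moore row at x.
  have horth : ∀ x ∈ S, ∀ i, ∑ j, (α j * x + β j) ^ p ^ i * algebraMap (ZMod p) k (h x j) = 0 := by
    intro x hx i
    have h1 := congrArg (fun a => a ^ p ^ i) (hroot x hx)
    simpa only [sum_pow_char_pow, mul_pow, algebraMap_zmod_pow, mul_comm,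
      zero_pow (pow_pos hp.pos i).ne'] using h1
  constructor
  · let Δ : k[X] := ∑ j, L j * mooreCofactor p (fun i => L i ^ p) j
    have hLp : ∀ j, ((fun i => L i ^ p) j).natDegree ≤ p := fun j => by
      simpa using natDegree_pow_le_of_le p (hLdeg j)
    have hdvd : zeroPoly S ∣ Δ := zeroPoly_dvd fun x hx => by
      have h1 : ∀ j, (mooreCofactor p (fun i => L i ^ p) j).eval x =
          mooreCofactor p (fun i => (α i * x + β i) ^ p) j := fun j => by
        simpa [hLeval] using map_mooreCofactor p (evalRingHom x) (fun i => L i ^ p) j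
      simp only [Δ, eval_finsetSum, eval_mul, h1, hLeval]
      refine sum_mul_mooreCofactor_eq_zero p (hvec x hx) (by simpa using horth x hx 0) fun i => ?_
      simpa only [← pow_mul, ← pow_succ'] using horth x hx (i + 1)
    have hcard : S.card = 1 + geomExp p (r + 1) * p := by
      rw [H.card_eq, geomExp_succ']; ring
    have hdeg : Δ.natDegree ≤ S.card := by
      refine natDegree_sum_le_of_forall_le _ _ fun j _ => natDegree_mul_le.trans ?_
      rw [hcard]
      exact add_le_add (hLdeg j) (natDegree_mooreCofactor_le p hLp j)
    have hne : Δ ≠ 0 := by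
      intro h0
      apply moore_ne_zero p hα
      have h1 := congrArg (fun q => q.coeff (1 + geomExp p (r + 1) * p)) h0
      simp only [Δ, finsetSum_coeff, coeff_zero] at h1
      rw [← h1]
      refine Finset.sum_congr rfl fun j _ => ?_
      rw [coeff_mul_add_eq_of_natDegree_le (hLdeg j) (natDegree_mooreCofactor_le p hLp j),
        coeff_mooreCofactor p hLp, hLcoeff]
      congr 2
      ext i
      have := coeff_pow_of_natDegree_le (n := 1) (m := p) (hLdeg i)
      rw [mul_one] at this
      rw [this, hLcoeff]
    obtain ⟨c, hc⟩ := eq_C_mul_of_monic_of_dvd Lagrange.nodal_monic hdvd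
      (by rwa [Lagrange.natDegree_nodal])
    have hc0 : c ≠ 0 := by
      rintro rfl
      exact hne (by simpa using hc)
    have h2 : derivative (derivative Δ) = 0 := by
      simp only [Δ, derivative_sum]
      refine Finset.sum_eq_zero fun j _ => ?_
      have h3 : derivative (mooreCofactor p (fun i => L i ^ p) j) = 0 :=
        derivative_mooreCofactor_eq_zero p (fun i => by simp [derivative_pow]) j
      rw [derivative_mul, h3, mul_zero, add_zero, derivative_mul, h3]
      simp [L]
    rw [hc, derivative_C_mul, derivative_C_mul] at h2
    exact (mul_eq_zero.1 h2).resolve_left (C_ne_zero.2 hc0)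
  -- At a pole the vector of minors is proportional to h x: bordering by a vector ℓ orthogonal to h
  -- x gives determinant zero.
  · have hM : ∀ x ∈ S, ∀ i j, algebraMap (ZMod p) k (h x i) * (mooreCofactor p L j).eval x =
        algebraMap (ZMod p) k (h x j) * (mooreCofactor p L i).eval x := by
      intro x hx i j
      have h1 : ∀ j, (mooreCofactor p L j).eval x =
          mooreCofactor p (fun i => α i * x + β i) j := fun j => by
        simpa [hLeval] using map_mooreCofactor p (evalRingHom x) L j
      have h2 := sum_mul_mooreCofactor_eq_zero p (hvec x hx)
        (y := fun i => α i * x + β i)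
        (ℓ := Pi.single j (algebraMap (ZMod p) k (h x i)) -
          Pi.single i (algebraMap (ZMod p) k (h x j)))
        (by simp [sub_mul, Pi.single_apply, Finset.sum_sub_distrib, mul_comm (algebraMap _ _ (h x i))])
        (fun i => horth x hx i)
      simpa [sub_mul, Pi.single_apply, Finset.sum_sub_distrib, sub_eq_zero, h1] using h2
    have hMdeg : ∀ j, (mooreCofactor p L j).natDegree ≤ geomExp p (r + 1) := fun j => by
      simpa using natDegree_mooreCofactor_le p hLdeg j
    have hprop : ∀ i j, R i * mooreCofactor p L j = R j * mooreCofactor p L i := by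
      intro i j
      rw [← sub_eq_zero]
      -- Both vectors are proportional to h x on S, and 2 g_(r+1) < p g_(r+1) + 1 = |S|.
      refine eq_zero_of_natDegree_lt_card_of_eval_eq_zero' _ S (fun x hx => ?_) ?_
      · rw [eval_sub, eval_mul, eval_mul, H.eval_eq x hx, H.eval_eq x hx]
        linear_combination (derivative (zeroPoly S)).eval x * hM x hx i j
      · have h1 : ∀ i j, (R i * mooreCofactor p L j).natDegree ≤ 2 * geomExp p (r + 1) :=
          fun i j => natDegree_mul_le.trans
            ((add_le_add (H.natDegree_le i) (hMdeg j)).trans (two_mul _).ge)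
        refine ((natDegree_sub_le _ _).trans (max_le (h1 i j) (h1 j i))).trans_lt ?_
        rw [H.card_eq, geomExp_succ' p (r + 1)]
        exact Nat.lt_succ_of_le (Nat.mul_le_mul_right _ hp.two_le)
    intro j
    obtain ⟨a, ha, hR⟩ := H.single_factor j
    have hdvd : zeroPoly (S.filter fun x => h x j = 0) ∣ mooreCofactor p L j := by
      refine zeroPoly_dvd fun y hy => ?_
      -- Since the numerators have no common zero, proportionality carries zeros of R j over to the
      -- minor.
      obtain ⟨i, hi⟩ := H.exists_eval_ne_zero y
      have h1 := congrArg (eval y) (hprop i j)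
      have h2 : (R j).eval y = 0 := by
        rw [hR, eval_mul, show eval y (zeroPoly _) = 0 from Lagrange.eval_nodal_at_node (v := id) hy,
          mul_zero]
      rw [eval_mul, eval_mul, h2, zero_mul, mul_eq_zero] at h1
      exact h1.resolve_left hi
    obtain ⟨c, hc⟩ := eq_C_mul_of_monic_of_dvd Lagrange.nodal_monic hdvd
      (by rw [Lagrange.natDegree_nodal, H.card_filter_single]; exact hMdeg j)
    have hc0 : c ≠ 0 := by
      rintro rfl
      rw [C_0, zero_mul] at hc
      have h3 := coeff_mooreCofactor p hLdeg j
      simp only [hc, coeff_zero, hLcoeff] at h3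
      refine sum_algebraMap_mul_mooreCofactor_ne_zero p hα (ℓ := Pi.single j 1) (by simp) ?_
      rw [Finset.sum_eq_single j (fun i _ hi => by simp [hi]) (by simp), ← h3, mul_zero]
    have h4 : derivative (derivative (mooreCofactor p L j)) = 0 :=
      derivative_derivative_mooreCofactor p (fun i => by simp [L]) j
    rw [hc, derivative_C_mul, derivative_C_mul] at h4
    rw [hR, derivative_C_mul, derivative_C_mul,
      (mul_eq_zero.1 h4).resolve_left (C_ne_zero.2 hc0), mul_zero]

theorem derivative_pow_mul_sub_eq [IsAlgClosed k] (H : IsPoleConfig p S h R) (hp2 : 2 < p)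
    (j : Fin (r + 2)) : derivative (zeroPoly S) ^ (p - 2) *
      (R j * derivative (zeroPoly S) - derivative (R j) * zeroPoly S) = R j ^ p := by
  obtain ⟨hQ, hR⟩ := H.derivative_derivative_eq_zero
  have hcard : S.card = p * geomExp p (r + 1) + 1 := by rw [H.card_eq, geomExp_succ']
  have hQdeg : (zeroPoly S).natDegree = S.card := Lagrange.natDegree_nodal
  rw [← sub_eq_zero]
  set D := derivative (zeroPoly S) ^ (p - 2) *
      (R j * derivative (zeroPoly S) - derivative (R j) * zeroPoly S) - R j ^ p with hD
  have hD' : derivative D = 0 := by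
    have h1 : derivative (derivative (zeroPoly S) ^ (p - 2)) = 0 := by
      rw [derivative_pow, hQ, mul_zero]
    have h2 : derivative (R j ^ p) = 0 := by simp [derivative_pow]
    rw [hD, derivative_sub, derivative_mul, h1, h2, derivative_sub, derivative_mul, derivative_mul,
      hQ, hR j]
    ring
  -- At a pole both terms equal h Q'^p, as h^p = h; a zero of a polynomial with zero derivative has
  -- multiplicity at least p.
  have hdvd : zeroPoly S ^ p ∣ D := prod_X_sub_C_pow_dvd fun x hx => by
    refine X_sub_C_pow_char_dvd p hD' ?_
    have h1 : eval x (zeroPoly S) = 0 := Lagrange.eval_nodal_at_node (v := id) hx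
    rw [hD, eval_sub, eval_mul, eval_pow, eval_sub, eval_mul, eval_mul, eval_pow, h1,
      H.eval_eq x hx, mul_pow]
    have h2 := algebraMap_zmod_pow (K := k) p (h x j) 1
    rw [pow_one] at h2
    have h3 : ∀ a : k, a ^ p = a ^ (p - 2) * a * a := fun a => by
      rw [← pow_succ, ← pow_succ]; congr 1; omega
    rw [h2, h3 (eval x _)]
    ring
  refine eq_zero_of_dvd_of_natDegree_lt hdvd ?_
  rw [natDegree_pow, hQdeg]
  have hd := H.natDegree_le j
  have hA : (derivative (zeroPoly S)).natDegree ≤ p * geomExp p (r + 1) := by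
    have := natDegree_derivative_le (zeroPoly S)
    omega
  have hR' : (derivative (R j)).natDegree ≤ geomExp p (r + 1) - 1 :=
    (natDegree_derivative_le _).trans (Nat.sub_le_sub_right hd 1)
  have hpos : 0 < geomExp p (r + 1) := by rw [geomExp_succ']; omega
  have h1 : (R j * derivative (zeroPoly S) - derivative (R j) * zeroPoly S).natDegree ≤
      geomExp p (r + 1) + p * geomExp p (r + 1) := by
    refine (natDegree_sub_le _ _).trans (max_le ?_ ?_)
    · exact natDegree_mul_le.trans (add_le_add hd hA)
    · refine natDegree_mul_le.trans ((add_le_add hR' hQdeg.le).trans ?_)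
      omega
  have h2 : D.natDegree ≤ max ((p - 2) * (p * geomExp p (r + 1)) +
      (geomExp p (r + 1) + p * geomExp p (r + 1))) (p * geomExp p (r + 1)) :=
    (natDegree_sub_le _ _).trans (max_le_max
      (natDegree_mul_le.trans (add_le_add (natDegree_pow_le_of_le _ hA) h1))
      (natDegree_pow_le_of_le _ hd))
  refine h2.trans_lt (max_lt ?_ ?_)
  · rw [hcard]
    obtain ⟨P, rfl⟩ : ∃ P, p = P + 2 := ⟨p - 2, by omega⟩
    rw [Nat.add_sub_cancel]
    nlinarith
  · rw [hcard]
    nlinarith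

/-- In characteristic `p > 2` there are no such pole configurations. -/
theorem false_of_two_lt [IsAlgClosed k] (H : IsPoleConfig p S h R) (hp2 : 2 < p) : False := by
  have hcard : S.card = p * geomExp p (r + 1) + 1 := by rw [H.card_eq, geomExp_succ']
  have hpos : 0 < geomExp p (r + 1) := by rw [geomExp_succ']; omega
  -- |S| is congruent to 1 modulo p, so the top coefficient survives differentiation.
  have hcoeff : (derivative (zeroPoly S)).coeff (p * geomExp p (r + 1)) = 1 := by
    have h1 := (Lagrange.nodal_monic (s := S) (v := id)).coeff_natDegree
    rw [Lagrange.natDegree_nodal, hcard] at h1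
    rw [coeff_derivative, h1]
    simp
  obtain ⟨y, hy⟩ := IsAlgClosed.exists_root (derivative (zeroPoly S)) (by
    intro h0
    have h1 := le_natDegree_of_ne_zero (hcoeff.trans_ne one_ne_zero)
    rw [natDegree_eq_of_degree_eq_some h0] at h1
    exact (Nat.mul_pos (by omega) hpos).not_ge h1)
  obtain ⟨i, hi⟩ := H.exists_eval_ne_zero y
  have h2 := congrArg (eval y) (H.derivative_pow_mul_sub_eq hp2 i)
  -- Here p > 2 is essential: the exponent p - 2 must be positive.
  rw [eval_mul, eval_pow, hy.eq_zero, zero_pow (by omega), zero_mul, eval_pow] at h2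
  exact pow_ne_zero p hi h2.symm

end IsPoleConfig

end Config

/-! ### From spaces of logarithmic forms to pole configurations -/

section Extraction

variable {k : Type*} [Field k]

theorem coeff_add (ω η : DiffForm k) : coeff (ω + η) = coeff ω + coeff η :=
  map_add (formEquiv k).symm ω η

theorem coeff_smul (f : RatFunc k) (ω : DiffForm k) : coeff (f • ω) = f * coeff ω :=
  map_smul (formEquiv k).symm f ω

theorem coeff_dX : coeff (dX k) = 1 := by
  rw [← one_smul (RatFunc k) (dX k)]
  exact (formEquiv k).symm_apply_apply 1

theorem coeff_eq_zero {ω : DiffForm k} : coeff ω = 0 ↔ ω = 0 :=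
  (formEquiv k).symm.map_eq_zero_iff

/-- The coefficient of the logarithmic differential `dF / F`. -/
noncomputable def logDeriv (F : RatFunc k) : RatFunc k :=
  coeff (F⁻¹ • KaehlerDifferential.D k (RatFunc k) F)

theorem logDeriv_mul {F G : RatFunc k} (hF : F ≠ 0) (hG : G ≠ 0) :
    logDeriv (F * G) = logDeriv F + logDeriv G := by
  rw [logDeriv, logDeriv, logDeriv, Derivation.leibniz, coeff_smul, coeff_smul, coeff_smul,
    coeff_add, coeff_smul, coeff_smul]
  field_simp
  ring

theorem logDeriv_C (c : k) : logDeriv (RatFunc.C c) = 0 := by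
  rw [logDeriv, ← RatFunc.algebraMap_eq_C, Derivation.map_algebraMap, smul_zero, coeff_eq_zero]

theorem logDeriv_X_sub_C (a : k) :
    logDeriv (RatFunc.X - RatFunc.C a) = (RatFunc.X - RatFunc.C a)⁻¹ := by
  rw [logDeriv, map_sub, ← RatFunc.algebraMap_eq_C, Derivation.map_algebraMap, sub_zero, coeff_smul,
    ← dX, coeff_dX, mul_one]

theorem X_sub_C_ratFunc (a : k) :
    algebraMap k[X] (RatFunc k) (X - C a) = RatFunc.X - RatFunc.C a := by
  rw [map_sub, RatFunc.algebraMap_X, RatFunc.algebraMap_C]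

theorem algebraMap_ratFunc_ne_zero {f : k[X]} (hf : f ≠ 0) : algebraMap k[X] (RatFunc k) f ≠ 0 :=
  (map_ne_zero_iff _ (RatFunc.algebraMap_injective k)).2 hf

variable (p : ℕ) [Fact p.Prime] [Algebra (ZMod p) k]

/-- The rational function with simple poles and prescribed residues in `𝔽_p`. -/
noncomputable def polarPart : (k →₀ ZMod p) →ₗ[ZMod p] RatFunc k :=
  Finsupp.linearCombination (ZMod p) fun x => (RatFunc.X - RatFunc.C x)⁻¹

/-- The logarithmic derivative turns the factorization into linear factors into a sum of simple
polar terms. -/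
theorem logDeriv_polynomial_mem [IsAlgClosed k] {f : k[X]} (hf : f ≠ 0) :
    logDeriv (algebraMap k[X] (RatFunc k) f) ∈ LinearMap.range (polarPart (k := k) p) := by
  rw [(IsAlgClosed.splits f).eq_prod_roots, map_mul, logDeriv_mul, RatFunc.algebraMap_C, logDeriv_C,
    zero_add]
  · induction f.roots using Multiset.induction_on with
    | empty =>
      rw [Multiset.map_zero, Multiset.prod_zero, ← C_1, RatFunc.algebraMap_C, logDeriv_C]
      exact zero_mem _
    | cons a s ih =>
      rw [Multiset.map_cons, Multiset.prod_cons, map_mul, logDeriv_mul, X_sub_C_ratFunc,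
        logDeriv_X_sub_C]
      · refine add_mem ⟨Finsupp.single a 1, ?_⟩ ih
        simp [polarPart]
      · exact algebraMap_ratFunc_ne_zero (X_sub_C_ne_zero a)
      · exact algebraMap_ratFunc_ne_zero (monic_multisetProd_X_sub_C s).ne_zero
  · exact algebraMap_ratFunc_ne_zero (C_ne_zero.2 (leadingCoeff_ne_zero.2 hf))
  · exact algebraMap_ratFunc_ne_zero (monic_multisetProd_X_sub_C _).ne_zero

/-- Logarithmic forms have simple poles with residues in `𝔽_p` and are sums of their polar
parts. -/
theorem IsLogarithmic.exists_polarPart_eq [IsAlgClosed k] {ω : DiffForm k} (h : IsLogarithmic ω) :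
    ∃ c : k →₀ ZMod p, polarPart p c = coeff ω := by
  obtain ⟨F, hF, rfl⟩ := h
  have hd : algebraMap k[X] (RatFunc k) F.denom ≠ 0 := algebraMap_ratFunc_ne_zero F.denom_ne_zero
  have h1 : F * algebraMap k[X] (RatFunc k) F.denom = algebraMap k[X] (RatFunc k) F.num := by
    nth_rewrite 1 [← F.num_div_denom]
    exact div_mul_cancel₀ _ hd
  have h2 := logDeriv_mul hF hd
  rw [h1] at h2
  change ∃ c, polarPart p c = logDeriv F
  rw [eq_sub_of_add_eq h2.symm]
  exact sub_mem (logDeriv_polynomial_mem p (RatFunc.num_ne_zero hF))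
    (logDeriv_polynomial_mem p F.denom_ne_zero)

section Numerator

variable [DecidableEq k]

/-- The numerator of `polarPart p c` over the denominator `zeroPoly S`. -/
noncomputable def polarNum (S : Finset k) (c : k →₀ ZMod p) : k[X] :=
  ∑ x ∈ S, C (algebraMap (ZMod p) k (c x)) * zeroPoly (S.erase x)

variable {p}

theorem algebraMap_polarNum {S : Finset k} {c : k →₀ ZMod p} (hc : c.support ⊆ S) :
    algebraMap k[X] (RatFunc k) (polarNum p S c) =
      polarPart p c * algebraMap k[X] (RatFunc k) (zeroPoly S) := by
  rw [polarPart, Finsupp.linearCombination_apply, Finsupp.sum_of_support_subset c hc _ (by simp),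
    Finset.sum_mul, polarNum, map_sum]
  refine Finset.sum_congr rfl fun x hx => ?_
  have h1 : zeroPoly S = (X - C x) * zeroPoly (S.erase x) :=
    Lagrange.nodal_eq_mul_nodal_erase (v := id) hx
  have h2 : RatFunc.X - RatFunc.C x ≠ 0 := by
    rw [← X_sub_C_ratFunc]
    exact algebraMap_ratFunc_ne_zero (X_sub_C_ne_zero x)
  rw [h1, map_mul, map_mul, X_sub_C_ratFunc, smul_mul_assoc, inv_mul_cancel_left₀ h2,
    Algebra.smul_def, RatFunc.algebraMap_C, IsScalarTower.algebraMap_apply (ZMod p) k (RatFunc k),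
    RatFunc.algebraMap_eq_C]

theorem eval_polarNum {S : Finset k} (c : k →₀ ZMod p) {x : k} (hx : x ∈ S) :
    (polarNum p S c).eval x =
      algebraMap (ZMod p) k (c x) * (derivative (zeroPoly S)).eval x := by
  have h1 := Lagrange.eval_nodal_derivative_eval_node_eq (v := id) hx
  rw [id] at h1
  rw [polarNum, eval_finsetSum, Finset.sum_eq_single x, eval_mul, eval_C, h1]
  · intro y _ hyx
    rw [eval_mul, show eval x (zeroPoly (S.erase y)) = 0 from
      Lagrange.eval_nodal_at_node (v := id) (Finset.mem_erase.2 ⟨hyx.symm, hx⟩), mul_zero]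
  · exact fun h => absurd hx h

end Numerator

/-- A form without finite zeros has a constant numerator. -/
theorem exists_num_eq_C [IsAlgClosed k] {ω : DiffForm k} (hω : ω ≠ 0)
    (h : ∀ a, ordAt a ω ≤ 0) : ∃ c, c ≠ 0 ∧ (coeff ω).num = C c := by
  have h0 : (coeff ω).num ≠ 0 := RatFunc.num_ne_zero (mt coeff_eq_zero.1 hω)
  by_cases hdeg : (coeff ω).num.degree = 0
  · rw [eq_C_of_degree_eq_zero hdeg] at h0 ⊢
    exact ⟨_, C_ne_zero.1 h0, rfl⟩
  · exfalso
    obtain ⟨a, ha⟩ := IsAlgClosed.exists_root _ hdeg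
    have h1 := (rootMultiplicity_pos h0).2 ha
    have h2 := h a
    rw [ordAt] at h2
    have h3 : (coeff ω).denom.IsRoot a :=
      (rootMultiplicity_pos (coeff ω).denom_ne_zero).1 (by omega)
    obtain ⟨u, v, huv⟩ := (coeff ω).isCoprime_num_denom
    have h4 := congrArg (eval a) huv
    rw [eval_add, eval_mul, eval_mul, ha.eq_zero, h3.eq_zero] at h4
    simp at h4

/-- The simple zeros of the product are shared out: those in T go to f, the others to g, and the
remaining cofactors are units. It is applied with f a numerator over Q and g the reduced
denominator. -/
theorem eq_C_mul_zeroPoly_of_mul_eq {S : Finset k} {f g : k[X]} {c : k} (hc : c ≠ 0) (T : k → Prop)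
    [DecidablePred T] (hT : ∀ x ∈ S, f.eval x = 0 ↔ T x) (h : f * g = C c * zeroPoly S) :
    (∃ a, a ≠ 0 ∧ f = C a * zeroPoly (S.filter T)) ∧
      g.natDegree = (S.filter fun x => ¬ T x).card := by
  obtain ⟨a, ha⟩ : zeroPoly (S.filter T) ∣ f := zeroPoly_dvd fun x hx =>
    (hT x (Finset.mem_filter.1 hx).1).2 (Finset.mem_filter.1 hx).2
  obtain ⟨b, hb⟩ : zeroPoly (S.filter fun x => ¬ T x) ∣ g := zeroPoly_dvd fun x hx => by
    rw [Finset.mem_filter] at hx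
    have h1 := congrArg (eval x) h
    rw [eval_mul, eval_mul, show eval x (zeroPoly S) = 0 from
      Lagrange.eval_nodal_at_node (v := id) hx.1, mul_zero] at h1
    exact (mul_eq_zero.1 h1).resolve_left (mt (hT x hx.1).1 hx.2)
  have hS : zeroPoly S = zeroPoly (S.filter T) * zeroPoly (S.filter fun x => ¬ T x) :=
    (Finset.prod_filter_mul_prod_filter_not S T _).symm
  have hab : a * b = C c := by
    have hS0 : zeroPoly S ≠ 0 := Lagrange.nodal_ne_zero
    refine mul_left_cancel₀ hS0 ?_
    rw [mul_comm _ (C c), ← h, ha, hb, hS]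
    ring
  have hu : IsUnit (a * b) := hab ▸ isUnit_C.2 hc.isUnit
  obtain ⟨a', ha', rfl⟩ := Polynomial.isUnit_iff.1 (isUnit_of_mul_isUnit_left hu)
  obtain ⟨b', hb', rfl⟩ := Polynomial.isUnit_iff.1 (isUnit_of_mul_isUnit_right hu)
  refine ⟨⟨a', ha'.ne_zero, ha.trans (mul_comm _ _)⟩, ?_⟩
  rw [hb, natDegree_mul_C hb'.ne_zero, Lagrange.natDegree_nodal]

variable {p}

/-- A space `L_{p^(r+1),r+2}` yields a pole configuration. -/
theorem IsSpaceL.exists_isPoleConfig [IsAlgClosed k] [DecidableEq k] {m r : ℕ}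
    {Ω : Submodule (ZMod p) (DiffForm k)} (H : IsSpaceL p m (r + 2) Ω) (hm : m + 1 = p ^ (r + 1)) :
    ∃ (S : Finset k) (h : k → Fin (r + 2) → ZMod p) (R : Fin (r + 2) → k[X]),
      IsPoleConfig p S h R := by
  have : Module.Finite (ZMod p) Ω :=
    Module.finite_of_finrank_pos (by rw [H.finrank_eq]; omega)
  let b := Module.finBasisOfFinrankEq (ZMod p) Ω H.finrank_eq
  have hb : ∀ j, ∃ c : k →₀ ZMod p, polarPart p c = coeff (b j : DiffForm k) := fun j =>
    (H.isLogarithmic _ (b j).2 fun h0 => b.ne_zero j (Subtype.ext h0)).exists_polarPart_eq p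
  choose c hc using hb
  let S : Finset k := Finset.univ.biUnion fun j => (c j).support
  have hS : ∀ j, (c j).support ⊆ S := fun j =>
    Finset.subset_biUnion_of_mem (fun j => (c j).support) (Finset.mem_univ j)
  let R : Fin (r + 2) → k[X] := fun j => polarNum p S (c j)
  let h : k → Fin (r + 2) → ZMod p := fun x j => c j x
  have heval : ∀ x ∈ S, ∀ j, (R j).eval x =
      algebraMap (ZMod p) k (h x j) * (derivative (zeroPoly S)).eval x :=
    fun x hx j => eval_polarNum (c j) hx
  have key : ∀ u : Fin (r + 2) → ZMod p, u ≠ 0 → (∃ a : k, a ≠ 0 ∧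
      ∑ j, C (algebraMap (ZMod p) k (u j)) * R j =
        C a * zeroPoly (S.filter fun x => h x ⬝ᵥ u = 0)) ∧
      m + 1 = (S.filter fun x => ¬ h x ⬝ᵥ u = 0).card := by
    intro u hu
    let ω : Ω := ∑ j, u j • b j
    have hω : (ω : DiffForm k) ≠ 0 := fun h0 => hu <| funext fun j =>
      Fintype.linearIndependent_iff.1 b.linearIndependent u (Subtype.ext h0) j
    obtain ⟨a, ha, hnum⟩ := exists_num_eq_C hω (H.ordAt_nonpos _ ω.2 hω)
    -- With a constant numerator, the order at ∞ is the degree of the denominator minus 2.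
    have hdeg : (coeff (ω : DiffForm k)).denom.natDegree = m + 1 := by
      have h1 := H.ordInfty_eq _ ω.2 hω
      rw [ordInfty, RatFunc.intDegree, hnum, natDegree_C] at h1
      push_cast at h1
      omega
    have hcoeff : coeff (ω : DiffForm k) = ∑ j, RatFunc.C (algebraMap (ZMod p) k (u j)) *
        polarPart p (c j) := by
      let φ : DiffForm k →+ RatFunc k := (formEquiv k).symm.toLinearMap.toAddMonoidHom
      change φ (ω : DiffForm k) = _
      simp only [ω, Submodule.coe_sum, Submodule.coe_smul, map_sum]
      refine Finset.sum_congr rfl fun j _ => ?_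
      rw [ZMod.map_smul φ, hc, Algebra.smul_def,
        IsScalarTower.algebraMap_apply (ZMod p) k (RatFunc k), RatFunc.algebraMap_eq_C]
      rfl
    have hRu : algebraMap k[X] (RatFunc k) (∑ j, C (algebraMap (ZMod p) k (u j)) * R j) =
        coeff (ω : DiffForm k) * algebraMap k[X] (RatFunc k) (zeroPoly S) := by
      rw [hcoeff, Finset.sum_mul, map_sum]
      refine Finset.sum_congr rfl fun j _ => ?_
      rw [map_mul, RatFunc.algebraMap_C, algebraMap_polarNum (hS j), mul_assoc]
    have hmul : (∑ j, C (algebraMap (ZMod p) k (u j)) * R j) * (coeff (ω : DiffForm k)).denom =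
        C a * zeroPoly S := by
      apply RatFunc.algebraMap_injective k
      rw [map_mul, hRu, map_mul, ← hnum]
      nth_rewrite 1 [← RatFunc.num_div_denom (coeff (ω : DiffForm k))]
      rw [mul_right_comm, div_mul_cancel₀]
      exact algebraMap_ratFunc_ne_zero (RatFunc.denom_ne_zero _)
    rw [← hdeg]
    refine eq_C_mul_zeroPoly_of_mul_eq ha (fun x => h x ⬝ᵥ u = 0) (fun x hx => ?_) hmul
    have h2 : (∑ j, C (algebraMap (ZMod p) k (u j)) * R j).eval x =
        algebraMap (ZMod p) k (h x ⬝ᵥ u) * (derivative (zeroPoly S)).eval x := by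
      rw [eval_finsetSum, dotProduct, map_sum, Finset.sum_mul]
      refine Finset.sum_congr rfl fun j _ => ?_
      rw [eval_mul, eval_C, heval x hx, map_mul]
      ring
    rw [h2, mul_eq_zero, or_iff_left (eval_derivative_zeroPoly_ne_zero hx), map_eq_zero]
  refine ⟨S, h, R, heval, fun u hu => (key u hu).1, fun u hu => ?_, fun x hx h0 => ?_⟩
  · rw [← hm, (key u hu).2]
  · obtain ⟨j, -, hj⟩ := Finset.mem_biUnion.1 hx
    exact Finsupp.mem_support_iff.1 hj (congrFun h0 j)

end Extraction

end SpacesL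

/-! ### Conclusion -/

theorem mainTheorem4 (p : ℕ) [Fact p.Prime] (hp : 2 < p)
    (k : Type*) [Field k] [IsAlgClosed k] [CharP k p] [Algebra (ZMod p) k]
    (m n : ℕ) (hn : 1 ≤ n) (hm : m + 1 = p ^ (n - 1)) :
    ¬ ∃ Ω : Submodule (ZMod p) (SpacesL.DiffForm k), SpacesL.IsSpaceL p m n Ω := by
  classical
  rintro ⟨Ω, H⟩
  match n, hn, hm, H with
  | 1, _, hm, H =>
    have := H.m_pos
    simp at hm
    omega
  | r + 2, _, hm, H =>
    obtain ⟨S, h, R, hconf⟩ := H.exists_isPoleConfig hm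
    exact hconf.false_of_two_lt hp
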